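/- Let $n, m \ge 0$ be integers, let $f_1, \dots, f_n \in \mathbb{R}$ and $q_0, \dots, q_m \in \mathbb{R}$ with $q_0 = 1$. Put $w_j^i := j^i$ for $j \in \{1, \dots, n\}$ and $w_0^i := 0$ for all $i \in \{0, \dots, m\}$ (also for $i = 0$), and consider the moment problem for distributions $x$ on $\{1, \dots, n\}$ with increasing failure rate, written in the tail probabilities $y_j = \sum_{k=j}^n x_k$, with $y_{n+1} := 0$: $$ \text{(DMP-IFR')} \qquad \max_{y \in \mathbb{R}^n} \ \sum_{j=1}^n f_j (y_j - y_{j+1}) $$ subject to $$ \sum_{j=1}^n (w_j^i - w_{j-1}^i)\, y_j = q_i \quad (0 \le i \le m), \qquad y_{j-1} y_{j+1} \le y_j^2 \quad (1 < j < n), $$ $$ y_j - y_{j+1} \ge 0 \quad (1 \le j < n), \qquad y_j \ge 0 \quad (1 \le j \le n). $$ A point $y$ of the (in general nonconvex) feasible region $S$ is called an extreme point of $S$ if there are no $d \ne 0$ in $\mathbb{R}^n$ and $\varepsilon > 0$ with $y + \varepsilon d \in S$ and $y - \varepsilon d \in S$. If (DMP-IFR') is feasible, then it has an optimal solution that is an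 extreme point of the feasible region. Moreover, for every optimal solution $y^*$ that is an extreme point of the feasible region there are integers $1 \le j_1 < j_2 \le n+1$ such that $y^*_j = 1$ for $1 \le j \le j_1$ and $y^*_j = 0$ for $j_2 \le j \le n$, and $[j_1, j_2 - 1]$ is divided into at most $m$ pieces on each of which $y^*$ is geometric: there are an integer $0 \le M \le m$, integers $j_1 = t_0 < t_1 < \dots < t_M = j_2 - 1$ and real numbers $\alpha_i > 0$, $0 < r_i < 1$ for $i \in \{1, \dots, M\}$ such that, with $u_i = t_{i-1}$ and $v_i = t_i$, $$ y^*_j = \alpha_i r_i^{\,j - u_i} \quad \text{for all integers } u_i \le j \le v_i, \quad i = 1, \dots, M. $$ (For $M = 0$ this means $j_2 = j_1 + 1$.) -/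

import Mathlib

namespace IFRMoment

/-- The entry `z_j` of a vector `z = (z_1, …, z_n)`, with one-based index `j`;
it is `0` for `j` outside `[1, n]`, so that in particular `z_0 = z_{n+1} = 0`. -/
def coord {n : ℕ} (z : Fin n → ℝ) (j : ℕ) : ℝ :=
  if h : 1 ≤ j ∧ j ≤ n then z ⟨j - 1, by omega⟩ else 0

/-- The powers `w_j ^ i` of the sample points `w_j = j`, with the convention that
`w_0 ^ i` stands for `0` for every exponent `i`, also for `i = 0`. -/
def wpow (j i : ℕ) : ℝ :=
  if j = 0 then 0 else (j : ℝ) ^ i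

/-- The feasible region of the moment problem for distributions on `{1, …, n}` with increasing
failure rate, in terms of the tail probabilities `y_j = x_j + ⋯ + x_n`. -/
def feasibleSet (n m : ℕ) (q : Fin (m + 1) → ℝ) : Set (Fin n → ℝ) :=
  {y | (∀ i : Fin (m + 1),
          ∑ j ∈ Finset.Icc 1 n, (wpow j i - wpow (j - 1) i) * coord y j = q i) ∧
       (∀ j : ℕ, 1 < j → j < n → coord y (j - 1) * coord y (j + 1) ≤ coord y j ^ 2) ∧
       (∀ j : ℕ, 1 ≤ j → j < n → 0 ≤ coord y j - coord y (j + 1)) ∧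
       (∀ j : ℕ, 1 ≤ j → j ≤ n → 0 ≤ coord y j)}

/-- The objective `∑ f_j (y_j - y_{j+1})`, where `y_{n+1} = 0`. -/
def objective {n : ℕ} (f y : Fin n → ℝ) : ℝ :=
  ∑ j ∈ Finset.Icc 1 n, coord f j * (coord y j - coord y (j + 1))

/-- An optimal solution of the maximization problem. -/
def IsOptimal (n m : ℕ) (f : Fin n → ℝ) (q : Fin (m + 1) → ℝ) (y : Fin n → ℝ) : Prop :=
  y ∈ feasibleSet n m q ∧ ∀ z ∈ feasibleSet n m q, objective f z ≤ objective f y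

/-- An extreme point of a set that need not be convex: a point `x` of the set such that there is
no direction `d ≠ 0` and no `ε > 0` with both `x + ε d` and `x - ε d` in the set.
(For sets that are not convex this is weaker than `x ∈ Set.extremePoints ℝ S`.) -/
def IsExtremePoint {n : ℕ} (S : Set (Fin n → ℝ)) (x : Fin n → ℝ) : Prop :=
  x ∈ S ∧ ∀ d : Fin n → ℝ, d ≠ 0 → ∀ ε : ℝ, 0 < ε → ¬ (x + ε • d ∈ S ∧ x - ε • d ∈ S)

/-- An optimal extreme point solution. -/
def IsOptimalExtremePoint (n m : ℕ) (f : Fin n → ℝ) (q : Fin (m + 1) → ℝ)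
    (y : Fin n → ℝ) : Prop :=
  IsOptimal n m f q y ∧ IsExtremePoint (feasibleSet n m q) y

/-- The sequence `y` is geometric on each of the `M` consecutive integer intervals
`[u_i, v_i]`, `v_i = u_{i+1}`, that divide `[a, b]`: here `u_i = t (i - 1)` and `v_i = t i`
for `i = 1, …, M`, and all ratios lie strictly between `0` and `1`.
For `M = 0` the condition says just `a = b`. -/
def IsPiecewiseGeometric {n : ℕ} (y : Fin n → ℝ) (a b M : ℕ) : Prop :=
  ∃ (t : Fin (M + 1) → ℕ) (α r : Fin M → ℝ),
    StrictMono t ∧ t 0 = a ∧ t (Fin.last M) = b ∧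
    ∀ i : Fin M, 0 < α i ∧ 0 < r i ∧ r i < 1 ∧
      ∀ j : ℕ, t i.castSucc ≤ j → j ≤ t i.succ →
        coord y j = α i * r i ^ (j - t i.castSucc)

end IFRMoment

namespace IFRMoment

open Filter Topology

lemma coord_add_smul {n : ℕ} (y d : Fin n → ℝ) (ε : ℝ) (j : ℕ) :
    coord (y + ε • d) j = coord y j + ε * coord d j := by
  unfold coord
  split_ifs <;> simp

lemma coord_of_gt {n : ℕ} (y : Fin n → ℝ) {j : ℕ} (h : n < j) : coord y j = 0 := by
  unfold coord
  rw [dif_neg (by omega)]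

lemma coord_succ {n : ℕ} (y : Fin n → ℝ) (k : Fin n) : coord y (k + 1) = y k := by
  unfold coord
  rw [dif_pos ⟨by omega, by omega⟩]
  rfl

lemma continuous_coord {n : ℕ} (j : ℕ) : Continuous fun y : Fin n → ℝ => coord y j := by
  unfold coord
  split_ifs <;> fun_prop

/-- The difference of consecutive zeroth powers is the indicator of `j = 1`. -/
lemma sum_wpow_zero (n : ℕ) (hn : 1 ≤ n) (z : ℕ → ℝ) :
    ∑ j ∈ Finset.Icc 1 n, (wpow j 0 - wpow (j - 1) 0) * z j = z 1 := by
  rw [Finset.sum_eq_single 1]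
  · simp [wpow]
  · intro j hj hj1
    rw [Finset.mem_Icc] at hj
    simp [wpow, show j ≠ 0 by omega, show j - 1 ≠ 0 by omega]
  · intro h
    simp [hn] at h

section Feasible

variable {n m : ℕ} {q : Fin (m + 1) → ℝ} {y : Fin n → ℝ}

lemma one_le_of_mem_feasibleSet (hq : q 0 = 1) (hy : y ∈ feasibleSet n m q) : 1 ≤ n := by
  by_contra h
  obtain rfl : n = 0 := by omega
  have := hy.1 0
  simp [hq] at this

lemma coord_one (hq : q 0 = 1) (hy : y ∈ feasibleSet n m q) : coord y 1 = 1 := by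
  have h := hy.1 0
  rw [hq] at h
  rw [← h]
  exact (sum_wpow_zero n (one_le_of_mem_feasibleSet hq hy) (coord y)).symm

lemma coord_nonneg (hy : y ∈ feasibleSet n m q) (j : ℕ) : 0 ≤ coord y j := by
  by_cases h : 1 ≤ j ∧ j ≤ n
  · exact hy.2.2.2 j h.1 h.2
  · unfold coord
    rw [dif_neg h]

lemma coord_succ_le (hy : y ∈ feasibleSet n m q) {j : ℕ} (hj : 1 ≤ j) :
    coord y (j + 1) ≤ coord y j := by
  by_cases h : j < n
  · have := hy.2.2.1 j hj h
    linarith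
  · rw [coord_of_gt y (by omega)]
    exact coord_nonneg hy j

lemma coord_mul_le (hy : y ∈ feasibleSet n m q) {j : ℕ} (hj : 1 ≤ j) :
    coord y j * coord y (j + 2) ≤ coord y (j + 1) ^ 2 := by
  by_cases h : j + 1 < n
  · exact hy.2.1 (j + 1) (by omega) h
  · rw [coord_of_gt y (j := j + 2) (by omega), mul_zero]
    positivity

lemma coord_le_one (hq : q 0 = 1) (hy : y ∈ feasibleSet n m q) {j : ℕ} (hj : 1 ≤ j) :
    coord y j ≤ 1 := by
  induction j, hj using Nat.le_induction with
  | base => exact (coord_one hq hy).le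
  | succ j hj ih => exact (coord_succ_le hy hj).trans ih

end Feasible

lemma isClosed_feasibleSet (n m : ℕ) (q : Fin (m + 1) → ℝ) : IsClosed (feasibleSet n m q) := by
  have hc := continuous_coord (n := n)
  simp only [feasibleSet, Set.ofPred_and, Set.ofPred_forall]
  refine .inter ?_ (.inter ?_ (.inter ?_ ?_))
  · exact isClosed_iInter fun i => isClosed_eq
      (continuous_finsetSum _ fun j _ => continuous_const.mul (hc j)) continuous_const
  · exact isClosed_iInter fun j => isClosed_iInter fun _ => isClosed_iInter fun _ =>
      isClosed_le ((hc _).mul (hc _)) ((hc _).pow 2)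
  · exact isClosed_iInter fun j => isClosed_iInter fun _ => isClosed_iInter fun _ =>
      isClosed_le continuous_const ((hc _).sub (hc _))
  · exact isClosed_iInter fun j => isClosed_iInter fun _ => isClosed_iInter fun _ =>
      isClosed_le continuous_const (hc _)

lemma isCompact_feasibleSet {n m : ℕ} {q : Fin (m + 1) → ℝ} (hq : q 0 = 1) :
    IsCompact (feasibleSet n m q) := by
  refine (isCompact_univ_pi fun _ : Fin n => isCompact_Icc (a := (0 : ℝ)) (b := 1)).of_isClosed_subset
    (isClosed_feasibleSet n m q) ?_
  intro y hy k _
  rw [← coord_succ y k]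
  exact ⟨coord_nonneg hy _, coord_le_one hq hy (by omega)⟩

lemma continuous_objective {n : ℕ} (f : Fin n → ℝ) : Continuous (objective f) :=
  continuous_finsetSum _ fun j _ =>
    continuous_const.mul ((continuous_coord j).sub (continuous_coord (j + 1)))

lemma objective_add_smul {n : ℕ} (f y d : Fin n → ℝ) (ε : ℝ) :
    objective f (y + ε • d) = objective f y + ε * objective f d := by
  simp only [objective, coord_add_smul, Finset.mul_sum, ← Finset.sum_add_distrib]
  exact Finset.sum_congr rfl fun j _ => by ring

/-- Over a nonempty compact set, an optimal solution of largest Euclidean norm is extreme. -/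
lemma exists_isOptimalExtremePoint {n m : ℕ} (f : Fin n → ℝ) {q : Fin (m + 1) → ℝ}
    (hq : q 0 = 1) (hfeas : (feasibleSet n m q).Nonempty) :
    ∃ y, IsOptimalExtremePoint n m f q y := by
  have hK := isCompact_feasibleSet (n := n) hq
  obtain ⟨x, hx, hxmax⟩ := hK.exists_isMaxOn hfeas (continuous_objective f).continuousOn
  have hF : IsCompact (feasibleSet n m q ∩ {y | objective f x ≤ objective f y}) :=
    hK.inter_right (isClosed_le continuous_const (continuous_objective f))
  obtain ⟨y, ⟨hyS, hyx⟩, hymax⟩ := hF.exists_isMaxOn ⟨x, hx, le_refl (objective f x)⟩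
    (f := fun z => ∑ k, z k ^ 2) (by fun_prop)
  have hopt : ∀ z ∈ feasibleSet n m q, objective f z ≤ objective f y :=
    fun z hz => (hxmax hz).trans hyx
  refine ⟨y, ⟨hyS, hopt⟩, hyS, ?_⟩
  rintro d hd ε hε ⟨hp, hm⟩
  have em : y - ε • d = y + (-ε) • d := by rw [neg_smul, sub_eq_add_neg]
  rw [em] at hm
  have hp' := hopt _ hp
  have hm' := hopt _ hm
  simp only [Set.mem_ofPred_eq] at hyx
  rw [objective_add_smul] at hp' hm'
  have h1 := hymax (show y + ε • d ∈ _ from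
    ⟨hp, by simp only [Set.mem_ofPred_eq]; rw [objective_add_smul]; linarith⟩)
  have h2 := hymax (show y + (-ε) • d ∈ _ from
    ⟨hm, by simp only [Set.mem_ofPred_eq]; rw [objective_add_smul]; linarith⟩)
  simp only [Set.mem_ofPred_eq, Pi.add_apply, Pi.smul_apply, smul_eq_mul] at h1 h2
  have h3 : ∑ k, (y k + ε * d k) ^ 2 + ∑ k, (y k + -ε * d k) ^ 2
      = 2 * ∑ k, y k ^ 2 + 2 * ε ^ 2 * ∑ k, d k ^ 2 := by
    simp only [Finset.mul_sum, ← Finset.sum_add_distrib]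
    exact Finset.sum_congr rfl fun j _ => by ring
  obtain ⟨k, hk⟩ := Function.ne_iff.mp hd
  have h4 : 0 < ∑ k, d k ^ 2 :=
    Finset.sum_pos' (fun _ _ => sq_nonneg _) ⟨k, Finset.mem_univ _, by
      have : d k ≠ 0 := hk
      positivity⟩
  have h5 : 0 < 2 * ε ^ 2 * ∑ k, d k ^ 2 := by positivity
  linarith

/-- A log-concave nonincreasing sequence that starts at `1` and ends at `0` is first constant,
then strictly decreasing, then zero. -/
lemma exists_profile {Y : ℕ → ℝ} {n : ℕ} (hn : 1 ≤ n) (h1 : Y 1 = 1) (h0 : ∀ j, 0 ≤ Y j)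
    (hanti : ∀ j, 1 ≤ j → Y (j + 1) ≤ Y j)
    (hlc : ∀ j, 1 ≤ j → Y j * Y (j + 2) ≤ Y (j + 1) ^ 2) (hlast : ∀ j, n < j → Y j = 0) :
    ∃ a p, 1 ≤ a ∧ a ≤ p ∧ p ≤ n ∧ (∀ j, 1 ≤ j → j ≤ a → Y j = 1) ∧ (∀ j, p < j → Y j = 0) ∧
      (∀ j, 1 ≤ j → j ≤ p → 0 < Y j) ∧ (∀ j, a ≤ j → j ≤ p → Y (j + 1) < Y j) := by
  classical
  have hmono : ∀ i j, 1 ≤ i → i ≤ j → Y j ≤ Y i := by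
    intro i j hi hij
    induction j, hij using Nat.le_induction with
    | base => exact le_rfl
    | succ j hj ih => exact (hanti j (hi.trans hj)).trans ih
  have hle : ∀ j, 1 ≤ j → Y j ≤ 1 := fun j hj => h1 ▸ hmono 1 j le_rfl hj
  set p := Nat.findGreatest (fun j => 0 < Y j) n with hp
  set a := Nat.findGreatest (fun j => Y j = 1) n with ha
  have hap : Y a = 1 := Nat.findGreatest_spec (P := fun j => Y j = 1) hn h1
  have hpp : 0 < Y p := Nat.findGreatest_spec (P := fun j => 0 < Y j) hn (by rw [h1]; norm_num)
  have ha1 : 1 ≤ a := Nat.le_findGreatest hn h1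
  have han : a ≤ n := Nat.findGreatest_le n
  have hle_p : a ≤ p := Nat.le_findGreatest han (by rw [hap]; norm_num)
  have hzero : ∀ j, p < j → Y j = 0 := by
    intro j hj
    by_cases h : j ≤ n
    · exact le_antisymm (not_lt.mp (Nat.findGreatest_is_greatest hj h)) (h0 j)
    · exact hlast j (by omega)
  have hpos : ∀ j, 1 ≤ j → j ≤ p → 0 < Y j := fun j hj hjp => hpp.trans_le (hmono j p hj hjp)
  refine ⟨a, p, ha1, hle_p, Nat.findGreatest_le n, ?_, hzero, hpos, ?_⟩
  · intro j hj hja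
    exact le_antisymm (hle j hj) (hap ▸ hmono j a hj hja)
  · intro j hj
    induction j, hj using Nat.le_induction with
    | base =>
      intro _
      rw [hap]
      refine lt_of_le_of_ne (hle _ (by omega)) fun h => ?_
      by_cases hn' : a + 1 ≤ n
      · exact Nat.findGreatest_is_greatest (Nat.lt_succ_self a) hn' h
      · rw [hlast _ (by omega)] at h
        norm_num at h
    | succ j hj ih =>
      intro hjp
      have hlt := ih (by omega)
      have hp1 := hpos (j + 1) (by omega) hjp
      have hl := hlc j (by omega)
      have hpj := hpos j (by omega) (by omega)
      refine lt_of_mul_lt_mul_left (a := Y j) ?_ hpj.le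
      show Y j * Y (j + 2) < Y j * Y (j + 1)
      nlinarith

/-- The left end points of the maximal geometric pieces of `Y` on `[a, p]`. -/
noncomputable def breakpoints (Y : ℕ → ℝ) (a p : ℕ) : Finset ℕ :=
  open Classical in {b ∈ Finset.Ico a p | b = a ∨ Y (b - 1) * Y (b + 1) ≠ Y b ^ 2}

/-- The continuous piecewise linear function with value `0` on `[0, min B]` whose slope changes
by `c b` at `b ∈ B`. -/
def pwLinear (B : Finset ℕ) (c : B → ℝ) (j : ℕ) : ℝ :=
  ∑ b : B, c b * ((j - (b : ℕ) : ℕ) : ℝ)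

lemma pwLinear_eq_zero {B : Finset ℕ} (c : B → ℝ) {j : ℕ} (h : ∀ b ∈ B, j ≤ b) :
    pwLinear B c j = 0 :=
  Finset.sum_eq_zero fun b _ => by
    rw [Nat.sub_eq_zero_of_le (h b b.2), Nat.cast_zero, mul_zero]

lemma pwLinear_add_eq {B : Finset ℕ} (c : B → ℝ) {j : ℕ} (h : j ∉ B) :
    pwLinear B c (j - 1) + pwLinear B c (j + 1) = 2 * pwLinear B c j := by
  simp only [pwLinear, Finset.mul_sum, ← Finset.sum_add_distrib]
  refine Finset.sum_congr rfl fun b _ => ?_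
  have hb : (b : ℕ) ≠ j := fun e => h (e ▸ b.2)
  have : (j - 1 - b : ℕ) + (j + 1 - b : ℕ) = 2 * (j - b : ℕ) := by omega
  have h' : ((j - 1 - b : ℕ) : ℝ) + ((j + 1 - b : ℕ) : ℝ) = 2 * ((j - b : ℕ) : ℝ) := by
    exact_mod_cast this
  linear_combination c b * h'

lemma exists_pwLinear_ne_zero {B : Finset ℕ} {c : B → ℝ} (hc : c ≠ 0) :
    ∃ b ∈ B, pwLinear B c (b + 1) ≠ 0 := by
  classical
  obtain ⟨k, hk⟩ := Function.ne_iff.mp hc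
  obtain ⟨b, hb, hmin⟩ := Finset.exists_min_image (Finset.univ.filter fun b : B => c b ≠ 0)
    (fun b => (b : ℕ)) ⟨k, by simpa using hk⟩
  have hcb : c b ≠ 0 := by simpa using hb
  refine ⟨b, b.2, ?_⟩
  rw [pwLinear, Finset.sum_eq_single b]
  · simpa using hcb
  · intro i _ hib
    by_cases hci : c i = 0
    · rw [hci, zero_mul]
    · have hle := hmin i (by simpa using hci)
      have hne : (i : ℕ) ≠ b := fun e => hib (Subtype.ext e)
      have : (b + 1 - i : ℕ) = 0 := by omega
      rw [this, Nat.cast_zero, mul_zero]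
  · simp

/-- A strict inequality at `0` between continuous functions persists near `0`. -/
lemma eventually_le_of_lt {g h : ℝ → ℝ} (hg : Continuous g) (hh : Continuous h)
    (h0 : g 0 < h 0) : ∀ᶠ ε in 𝓝 (0 : ℝ), g ε ≤ h ε :=
  (hg.continuousAt.eventually_lt hh.continuousAt h0).mono fun _ => le_of_lt

/-- An extreme point has at most `m` geometric pieces. -/
lemma card_breakpoints_le {n m : ℕ} {q : Fin (m + 1) → ℝ} (hq : q 0 = 1) {y : Fin n → ℝ}
    (hy : IsExtremePoint (feasibleSet n m q) y) {a p : ℕ} (ha : 1 ≤ a)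
    (hone : ∀ j, 1 ≤ j → j ≤ a → coord y j = 1) (hzero : ∀ j, p < j → coord y j = 0)
    (hpos : ∀ j, 1 ≤ j → j ≤ p → 0 < coord y j)
    (hlt : ∀ j, a ≤ j → j ≤ p → coord y (j + 1) < coord y j) :
    (breakpoints (coord y) a p).card ≤ m := by
  classical
  set B := breakpoints (coord y) a p with hB
  obtain ⟨hyS, hext⟩ := hy
  have hn := one_le_of_mem_feasibleSet hq hyS
  have hBmem : ∀ b ∈ B, a ≤ b ∧ b < p ∧
      (b = a ∨ coord y (b - 1) * coord y (b + 1) ≠ coord y b ^ 2) := by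
    intro b hb
    simpa [hB, breakpoints, and_assoc] using hb
  by_contra hcard
  let L : (B → ℝ) →ₗ[ℝ] (Fin m → ℝ) :=
    { toFun := fun c i => ∑ j ∈ Finset.Icc 1 n,
        (wpow j i.succ - wpow (j - 1) i.succ) * (coord y j * pwLinear B c j)
      map_add' := by
        intro c c'
        ext i
        simp only [Pi.add_apply, ← Finset.sum_add_distrib]
        refine Finset.sum_congr rfl fun j _ => ?_
        have : pwLinear B (c + c') j = pwLinear B c j + pwLinear B c' j := by
          simp [pwLinear, add_mul, Finset.sum_add_distrib]
        rw [this]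
        ring
      map_smul' := by
        intro r c
        ext i
        simp only [Pi.smul_apply, smul_eq_mul, Finset.mul_sum, RingHom.id_apply]
        refine Finset.sum_congr rfl fun j _ => ?_
        have : pwLinear B (r • c) j = r * pwLinear B c j := by
          simp [pwLinear, Finset.mul_sum, mul_assoc]
        rw [this]
        ring }
  have hker : LinearMap.ker L ≠ ⊥ :=
    LinearMap.ker_ne_bot_of_finrank_lt (by simpa using hcard)
  obtain ⟨c, hcL, hc⟩ := (Submodule.ne_bot_iff _).mp hker
  set e := pwLinear B c with he
  have he0 : ∀ j, j ≤ a → e j = 0 := fun j hj =>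
    pwLinear_eq_zero c fun b hb => hj.trans (hBmem b hb).1
  set d : Fin n → ℝ := fun k => y k * e (k + 1) with hd
  have hdc : ∀ j, coord d j = coord y j * e j := by
    intro j
    unfold coord
    split_ifs with h
    · simp only [hd]
      rw [show j - 1 + 1 = j by omega]
    · simp
  have hd0 : d ≠ 0 := by
    obtain ⟨b, hb, hne⟩ := exists_pwLinear_ne_zero hc
    intro h0
    have h1 : coord d (b + 1) = 0 := by rw [h0]; simp [coord]
    rw [hdc] at h1
    exact mul_ne_zero (hpos (b + 1) (by omega) (hBmem b hb).2.1).ne' hne h1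
  have hmom : ∀ i : Fin (m + 1), ∑ j ∈ Finset.Icc 1 n,
      (wpow j i - wpow (j - 1) i) * (coord y j * e j) = 0 := by
    intro i
    refine Fin.cases ?_ (fun i => ?_) i
    · have := sum_wpow_zero n hn fun j => coord y j * e j
      rw [he0 1 ha, mul_zero] at this
      exact this
    · exact congrFun (LinearMap.mem_ker.mp hcL) i
  have hev : ∀ᶠ ε in 𝓝 (0 : ℝ), y + ε • d ∈ feasibleSet n m q := by
    have E2 : ∀ᶠ ε in 𝓝 (0 : ℝ), ∀ j ∈ Finset.range n, 1 < j →
        coord (y + ε • d) (j - 1) * coord (y + ε • d) (j + 1) ≤ coord (y + ε • d) j ^ 2 := by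
      refine (Filter.eventually_all_finset _).mpr fun j hj => ?_
      rw [Finset.mem_range] at hj
      by_cases hj1 : 1 < j
      swap
      · exact Eventually.of_forall fun ε h => absurd h hj1
      simp only [coord_add_smul, hdc]
      rcases (hyS.2.1 j hj1 hj).lt_or_eq with hs | heq
      · refine (eventually_le_of_lt ?_ ?_ ?_).mono fun ε h _ => h
        · fun_prop
        · fun_prop
        · simpa using hs
      · have hjB : j ∉ B := by
          intro hjB
          obtain ⟨_, hjp, h | h⟩ := hBmem j hjB
          · have h1 := hone (j - 1) (by omega) (by omega)
            have h2 := hone j (by omega) h.le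
            have h3 := hlt j h.ge hjp.le
            rw [h1, h2] at heq
            rw [h2] at h3
            linarith
          · exact h heq
        have h2 := pwLinear_add_eq c hjB
        rw [← he] at h2
        refine Eventually.of_forall fun ε _ => ?_
        have key : (coord y j + ε * (coord y j * e j)) ^ 2 -
            (coord y (j - 1) + ε * (coord y (j - 1) * e (j - 1))) *
              (coord y (j + 1) + ε * (coord y (j + 1) * e (j + 1))) =
            (coord y j * ε * (e (j + 1) - e (j - 1)) / 2) ^ 2 := by
          have h3 : e j = (e (j - 1) + e (j + 1)) / 2 := by linarith
          rw [h3]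
          linear_combination (-(1 + ε * e (j - 1)) * (1 + ε * e (j + 1))) * heq
        have := sq_nonneg (coord y j * ε * (e (j + 1) - e (j - 1)) / 2)
        linarith
    have E3 : ∀ᶠ ε in 𝓝 (0 : ℝ), ∀ j ∈ Finset.range n, 1 ≤ j →
        coord (y + ε • d) (j + 1) ≤ coord (y + ε • d) j := by
      refine (Filter.eventually_all_finset _).mpr fun j hj => ?_
      simp only [coord_add_smul, hdc]
      rcases lt_or_ge j a with hja | hja
      · rw [he0 j hja.le, he0 (j + 1) hja]
        refine Eventually.of_forall fun ε h => ?_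
        simpa using coord_succ_le hyS h
      · rcases le_or_gt j p with hjp | hjp
        · refine (eventually_le_of_lt ?_ ?_ ?_).mono fun ε h _ => h
          · fun_prop
          · fun_prop
          · simpa using hlt j hja hjp
        · rw [hzero j hjp, hzero (j + 1) (by omega)]
          simp
    have E4 : ∀ᶠ ε in 𝓝 (0 : ℝ), ∀ j ∈ Finset.range (n + 1), 1 ≤ j →
        0 ≤ coord (y + ε • d) j := by
      refine (Filter.eventually_all_finset _).mpr fun j hj => ?_
      by_cases hj1 : 1 ≤ j
      swap
      · exact Eventually.of_forall fun ε h => absurd h hj1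
      simp only [coord_add_smul, hdc]
      rcases le_or_gt j p with hjp | hjp
      · refine (eventually_le_of_lt ?_ ?_ ?_).mono fun ε h _ => h
        · fun_prop
        · fun_prop
        · simpa using hpos j hj1 hjp
      · rw [hzero j hjp]
        simp
    filter_upwards [E2, E3, E4] with ε h2 h3 h4
    refine ⟨fun i => ?_, fun j hj hjn => h2 j (Finset.mem_range.mpr hjn) hj,
      fun j hj hjn => sub_nonneg.mpr (h3 j (Finset.mem_range.mpr hjn) hj),
      fun j hj hjn => h4 j (Finset.mem_range.mpr (by omega)) hj⟩
    rw [← hyS.1 i]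
    have h5 := hmom i
    simp only [coord_add_smul, hdc, mul_add, Finset.sum_add_distrib]
    rw [add_eq_left]
    rw [← mul_zero ε, ← h5, Finset.mul_sum]
    exact Finset.sum_congr rfl fun j _ => by ring
  obtain ⟨δ, hδ, hball⟩ := Metric.eventually_nhds_iff.mp hev
  refine hext d hd0 (δ / 2) (by positivity) ⟨hball ?_, ?_⟩
  · rw [Real.dist_eq, sub_zero, abs_of_pos (by positivity)]
    linarith
  · rw [sub_eq_add_neg, ← neg_smul]
    refine hball ?_
    rw [Real.dist_eq, sub_zero, abs_neg, abs_of_pos (by positivity)]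
    linarith

/-- A positive sequence with `Y_{j-1} Y_{j+1} = Y_j ^ 2` strictly between `u` and `v` is geometric
on `[u, v]`. -/
lemma eq_mul_pow_of_mul_eq_sq {Y : ℕ → ℝ} {u v : ℕ} (hpos : ∀ j, u ≤ j → j ≤ v → 0 < Y j)
    (heq : ∀ j, u < j → j < v → Y (j - 1) * Y (j + 1) = Y j ^ 2) {j : ℕ} (huj : u ≤ j)
    (hjv : j ≤ v) : Y j = Y u * (Y (u + 1) / Y u) ^ (j - u) := by
  have hratio : ∀ j, u ≤ j → j < v → Y (j + 1) = Y j * (Y (u + 1) / Y u) := by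
    intro j hj
    induction j, hj using Nat.le_induction with
    | base =>
      intro h
      have := hpos u le_rfl h.le
      field_simp
    | succ j hj ih =>
      intro h
      have h1 := ih (by omega)
      have h2 := heq (j + 1) (by omega) h
      rw [Nat.add_sub_cancel] at h2
      have h3 := hpos j hj (by omega)
      refine mul_left_cancel₀ h3.ne' ?_
      rw [h2]
      nth_rewrite 1 [sq, h1]
      ring
  induction j, huj using Nat.le_induction with
  | base => simp
  | succ j hj ih =>
    rw [hratio j hj hjv, ih (by omega), Nat.sub_add_comm hj, pow_succ]
    ring

lemma isPiecewiseGeometric_card_breakpoints {n : ℕ} {y : Fin n → ℝ} {a p : ℕ} (ha : 1 ≤ a)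
    (hap : a ≤ p) (hpos : ∀ j, 1 ≤ j → j ≤ p → 0 < coord y j)
    (hlt : ∀ j, a ≤ j → j ≤ p → coord y (j + 1) < coord y j) :
    IsPiecewiseGeometric y a p (breakpoints (coord y) a p).card := by
  classical
  set B := breakpoints (coord y) a p with hB
  have hBmem : ∀ b, b ∈ B ↔ (a ≤ b ∧ b < p) ∧
      (b = a ∨ coord y (b - 1) * coord y (b + 1) ≠ coord y b ^ 2) := by
    intro b
    simp [hB, breakpoints]
  have hpB : p ∉ B := fun h => lt_irrefl _ ((hBmem p).mp h).1.2
  have hcard : (insert p B).card = B.card + 1 := Finset.card_insert_of_notMem hpB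
  have hins : ∀ b ∈ insert p B, a ≤ b ∧ b ≤ p := by
    intro b hb
    rcases Finset.mem_insert.mp hb with rfl | hb
    · exact ⟨hap, le_rfl⟩
    · exact ⟨((hBmem b).mp hb).1.1, ((hBmem b).mp hb).1.2.le⟩
  have ha_mem : a ∈ insert p B := by
    rcases hap.eq_or_lt with h | h
    · rw [h]
      exact Finset.mem_insert_self _ _
    · exact Finset.mem_insert_of_mem ((hBmem a).mpr ⟨⟨le_rfl, h⟩, Or.inl rfl⟩)
  set t := (insert p B).orderEmbOfFin hcard with ht
  have htmem : ∀ i, t i ∈ insert p B := fun i => Finset.orderEmbOfFin_mem _ hcard i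
  have htsurj : ∀ b ∈ insert p B, ∃ i, t i = b := by
    intro b hb
    have : b ∈ Set.range t := by
      rw [ht, Finset.range_orderEmbOfFin]
      exact hb
    exact this
  refine ⟨t, fun i => coord y (t i.castSucc),
    fun i => coord y (t i.castSucc + 1) / coord y (t i.castSucc), t.strictMono, ?_, ?_, ?_⟩
  · obtain ⟨i, hi⟩ := htsurj a ha_mem
    exact le_antisymm (hi ▸ t.monotone (Fin.zero_le i)) (hins _ (htmem 0)).1
  · obtain ⟨i, hi⟩ := htsurj p (Finset.mem_insert_self _ _)
    exact le_antisymm (hins _ (htmem _)).2 (hi ▸ t.monotone (Fin.le_last i))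
  · intro i
    have hu := hins _ (htmem i.castSucc)
    have hv := hins _ (htmem i.succ)
    have huv : t i.castSucc < t i.succ := t.strictMono i.castSucc_lt_succ
    have h1 := hpos (t i.castSucc) (by omega) hu.2
    have h2 := hpos (t i.castSucc + 1) (by omega) (by omega)
    refine ⟨h1, div_pos h2 h1, (div_lt_one h1).mpr (hlt _ hu.1 hu.2), fun j huj hjv => ?_⟩
    refine eq_mul_pow_of_mul_eq_sq (fun k hk hk' => hpos k (by omega) (by omega)) ?_ huj hjv
    intro k hk hk'
    by_contra hne
    obtain ⟨l, hl⟩ := htsurj k (Finset.mem_insert_of_mem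
      ((hBmem k).mpr ⟨⟨by omega, by omega⟩, Or.inr hne⟩))
    rw [← hl] at hk hk'
    have h3 := t.lt_iff_lt.mp hk
    have h4 := t.lt_iff_lt.mp hk'
    rw [Fin.lt_def] at h3 h4
    simp only [Fin.val_castSucc, Fin.val_succ] at h3 h4
    omega

end IFRMoment

theorem mainTheorem3 (n m : ℕ) (f : Fin n → ℝ) (q : Fin (m + 1) → ℝ) (hq : q 0 = 1)
    (hfeas : (IFRMoment.feasibleSet n m q).Nonempty) :
    (∃ y : Fin n → ℝ, IFRMoment.IsOptimalExtremePoint n m f q y) ∧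
    ∀ y : Fin n → ℝ, IFRMoment.IsOptimalExtremePoint n m f q y →
      ∃ j₁ j₂ : ℕ, 1 ≤ j₁ ∧ j₁ < j₂ ∧ j₂ ≤ n + 1 ∧
        (∀ j : ℕ, 1 ≤ j → j ≤ j₁ → IFRMoment.coord y j = 1) ∧
        (∀ j : ℕ, j₂ ≤ j → j ≤ n → IFRMoment.coord y j = 0) ∧
        ∃ M : ℕ, M ≤ m ∧ IFRMoment.IsPiecewiseGeometric y j₁ (j₂ - 1) M := by
  refine ⟨IFRMoment.exists_isOptimalExtremePoint f hq hfeas, fun y hy => ?_⟩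
  have hyS := hy.2.1
  obtain ⟨a, p, ha, hap, hpn, hone, hzero, hpos, hlt⟩ := IFRMoment.exists_profile
    (IFRMoment.one_le_of_mem_feasibleSet hq hyS) (IFRMoment.coord_one hq hyS)
    (IFRMoment.coord_nonneg hyS) (fun _ => IFRMoment.coord_succ_le hyS)
    (fun _ => IFRMoment.coord_mul_le hyS) (fun _ => IFRMoment.coord_of_gt y)
  exact ⟨a, p + 1, ha, by omega, by omega, hone, fun j hj _ => hzero j hj, _,
    IFRMoment.card_breakpoints_le hq hy.2 ha hone hzero hpos hlt,
    IFRMoment.isPiecewiseGeometric_card_breakpoints ha hap hpos hlt⟩
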